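/- Let $\mathcal{S}$ be a finite source alphabet with $|\mathcal{S}| \ge 2$, let $\mu : \mathcal{S} \to \mathbb{R}$ be a probability distribution with $\mu(s) > 0$ for every $s \in \mathcal{S}$, and let $\mathcal{C} = \{0,1\}$. Write $\lambda$ for the empty sequence and $\preceq$ (resp. $\prec$) for "is a prefix of" (resp. "is a proper prefix of"). A code-tuple $F$ consists of an integer $m = |F| \ge 1$ and maps $f_i : \mathcal{S} \to \mathcal{C}^*$ and $\tau_i : \mathcal{S} \to [F] := \{0, \dots, m-1\}$ for $i \in [F]$. Put $f_i^*(\lambda) = \lambda$, $\tau_i^*(\lambda) = i$, and $f_i^*(s\boldsymbol{x}) = f_i(s) f^*_{\tau_i(s)}(\boldsymbol{x})$, $\tau_i^*(s\boldsymbol{x}) = \tau^*_{\tau_i(s)}(\boldsymbol{x})$ for $s \in \mathcal{S}$, $\boldsymbol{x} \in \mathcal{S}^*$. For $k \ge 0$, $i \in [F]$ and $\boldsymbol{b} \in \mathcal{C}^*$ let $$\mathcal{P}^k_{F,i}(\boldsymbol{b}) = \{\boldsymbol{c} \in \mathcal{C}^k : \boldsymbol{b}\boldsymbol{c} \preceq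 f_i^*(\boldsymbol{x}) \text{ and } \boldsymbol{b} \preceq f_i(x_1) \text{ for some non-empty } \boldsymbol{x} = x_1 x_2 \dots x_n \in \mathcal{S}^*\},$$ let $\bar{\mathcal{P}}^k_{F,i}(\boldsymbol{b})$ be defined in the same way with $\boldsymbol{b} \prec f_i(x_1)$ in place of $\boldsymbol{b} \preceq f_i(x_1)$, and put $\mathcal{P}^k_{F,i} = \mathcal{P}^k_{F,i}(\lambda)$ and $\mathcal{P}^*_{F,i} = \bigcup_{k \ge 0} \mathcal{P}^k_{F,i}$ (so $\mathcal{P}^*_{F,i}$ is the set of all prefixes of codeword sequences $f_i^*(\boldsymbol{x})$, $\boldsymbol{x} \in \mathcal{S}^*$). The code-tuple $F$ is $k$-bit delay decodable if $\mathcal{P}^k_{F,\tau_i(s)} \cap \bar{\mathcal{P}}^k_{F,i}(f_i(s)) = \emptyset$ for all $i \in [F]$, $s \in \mathcal{S}$, and $\mathcal{P}^k_{F,\tau_i(s)} \cap \mathcal{P}^k_{F,\tau_i(s')} = \emptyset$ whenever $s \ne s'$ and $f_i(s) = f_i(s')$. It is extendable if $\mathcal{P}^1_{F,i} \ne \emptyset$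 for all $i \in [F]$. It is regular if there is exactly one vector $\boldsymbol{\pi} = \boldsymbol{\pi}(F) \in \mathbb{R}^{|F|}$ with $\boldsymbol{\pi} Q(F) = \boldsymbol{\pi}$ and $\sum_i \pi_i = 1$, where $Q_{i,j}(F) = \sum_{s : \tau_i(s) = j} \mu(s)$; its average codeword length is then $L(F) = \sum_{i \in [F]} \pi_i(F) \sum_{s \in \mathcal{S}} |f_i(s)|\, \mu(s)$. A code-tuple is an optimal $k$-bit delay decodable code-tuple if it minimizes $L$ among all code-tuples (with any number of tables) that are regular, extendable and $k$-bit delay decodable. Finally, let $\mathcal{R}_F$ be the set of all $i \in [F]$ such that for every $j \in [F]$ there is $\boldsymbol{x} \in \mathcal{S}^*$ with $\tau_j^*(\boldsymbol{x}) = i$ (for regular $F$ these are exactly the $i$ with $\pi_i(F) > 0$). Theorem. For every integer $k \ge 0$, every optimal $k$-bit delay decodable code-tuple $F$, every $i \in \mathcal{R}_F$ and every $\boldsymbol{b} = b_1 b_2 \dots b_l \in \mathcal{C}^*$ of length $l \ge k$: if $b_1 b_2 \dots b_k \in \mathcal{P}^k_{F,i}$, then $\boldsymbol{b} \in \mathcal{P}^*_{F,i}$,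 that is, $\boldsymbol{b}$ is a prefix of $f_i^*(\boldsymbol{x})$ for some $\boldsymbol{x} \in \mathcal{S}^*$. -/

import Mathlib

/-- A code-tuple over the source alphabet `S`, with coding alphabet `{0, 1} = Bool`: a positive
number `size` of code tables `f i : S → {0,1}*`, and for each of them a map `τ i` that gives the
index of the next code table after encoding a symbol. Indices range over `{0, …, size - 1}`. -/
structure CodeTuple (S : Type*) where
  size : ℕ
  size_pos : 0 < size
  f : Fin size → S → List Bool
  τ : Fin size → S → Fin size

namespace CodeTuple

/-- The codeword sequence of a source sequence, the first symbol being encoded with table `i`. -/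
def fStar {S : Type*} (F : CodeTuple S) : Fin F.size → List S → List Bool
  | _, [] => []
  | i, x :: xs => F.f i x ++ F.fStar (F.τ i x) xs

/-- The index of the table used next after encoding a source sequence, the first symbol being
encoded with table `i`. -/
def τStar {S : Type*} (F : CodeTuple S) : Fin F.size → List S → Fin F.size
  | i, [] => i
  | i, x :: xs => F.τStar (F.τ i x) xs

/-- The set `𝒫^k_{F,i}(b)` of all `c ∈ {0,1}^k` such that there is a non-empty source sequence
`x = x₁x₂…` with `b c ≼ f*_i(x)` and `b ≼ f_i(x₁)`. -/
def pref {S : Type*} (F : CodeTuple S) (k : ℕ) (i : Fin F.size) (b : List Bool) :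
    Set (List Bool) :=
  {c | c.length = k ∧ ∃ (x₁ : S) (xs : List S), b ++ c <+: F.fStar i (x₁ :: xs) ∧ b <+: F.f i x₁}

/-- The set `𝒫̄^k_{F,i}(b)`: the same, with `b` a proper prefix of `f_i(x₁)`. -/
def prefBar {S : Type*} (F : CodeTuple S) (k : ℕ) (i : Fin F.size) (b : List Bool) :
    Set (List Bool) :=
  {c | c.length = k ∧ ∃ (x₁ : S) (xs : List S),
    b ++ c <+: F.fStar i (x₁ :: xs) ∧ b <+: F.f i x₁ ∧ b ≠ F.f i x₁}

/-- The set `𝒫*_{F,i}(b)`, the union of the `𝒫^k_{F,i}(b)` over all `k ≥ 0`. -/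
def prefStar {S : Type*} (F : CodeTuple S) (i : Fin F.size) (b : List Bool) : Set (List Bool) :=
  ⋃ k : ℕ, F.pref k i b

/-- `k`-bit delay decodable code-tuples. -/
def IsDelayDecodable {S : Type*} (F : CodeTuple S) (k : ℕ) : Prop :=
  (∀ (i : Fin F.size) (s : S), F.pref k (F.τ i s) [] ∩ F.prefBar k i (F.f i s) = ∅) ∧
  (∀ (i : Fin F.size) (s s' : S), s ≠ s' → F.f i s = F.f i s' →
    F.pref k (F.τ i s) [] ∩ F.pref k (F.τ i s') [] = ∅)

/-- Extendable code-tuples. -/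
def IsExtendable {S : Type*} (F : CodeTuple S) : Prop :=
  ∀ i : Fin F.size, (F.pref 1 i []).Nonempty

/-- The transition probability matrix `Q(F)`, for the distribution `μ` of the source symbols. -/
noncomputable def transMatrix {S : Type*} [Fintype S] (F : CodeTuple S) (μ : S → ℝ) :
    Matrix (Fin F.size) (Fin F.size) ℝ :=
  Matrix.of fun i j => ∑ s : S with F.τ i s = j, μ s

/-- Stationary distributions: solutions `π` of `π Q(F) = π` and `∑ π_i = 1`. -/
def IsStationary {S : Type*} [Fintype S] (F : CodeTuple S) (μ : S → ℝ)
    (π : Fin F.size → ℝ) : Prop :=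
  Matrix.vecMul π (F.transMatrix μ) = π ∧ ∑ i, π i = 1

/-- Regular code-tuples: those with a unique stationary distribution. -/
def IsRegular {S : Type*} [Fintype S] (F : CodeTuple S) (μ : S → ℝ) : Prop :=
  ∃! π : Fin F.size → ℝ, F.IsStationary μ π

/-- The unique stationary distribution `π(F)` of a regular code-tuple. -/
noncomputable def stationaryDist {S : Type*} [Fintype S] (F : CodeTuple S) (μ : S → ℝ)
    (hF : F.IsRegular μ) : Fin F.size → ℝ :=
  hF.choose

/-- The average codeword length `L_i(F)` of the single code table `f_i`. -/
noncomputable def tableLength {S : Type*} [Fintype S] (F : CodeTuple S) (μ : S → ℝ)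
    (i : Fin F.size) : ℝ :=
  ∑ s : S, ((F.f i s).length : ℝ) * μ s

/-- The average codeword length `L(F)` of a regular code-tuple. -/
noncomputable def avgLength {S : Type*} [Fintype S] (F : CodeTuple S) (μ : S → ℝ)
    (hF : F.IsRegular μ) : ℝ :=
  ∑ i, F.stationaryDist μ hF i * F.tableLength μ i

/-- The set `ℛ_F` of the indices that can be reached from every index. -/
def reachable {S : Type*} (F : CodeTuple S) : Set (Fin F.size) :=
  {i | ∀ j : Fin F.size, ∃ x : List S, F.τStar j x = i}

/-- Optimal `k`-bit delay decodable code-tuples: those of minimal average codeword length among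
the regular, extendable and `k`-bit delay decodable code-tuples (with any number of tables). -/
def IsOptimal {S : Type*} [Fintype S] (F : CodeTuple S) (μ : S → ℝ) (k : ℕ) : Prop :=
  F.IsExtendable ∧ F.IsDelayDecodable k ∧
    ∃ hF : F.IsRegular μ, ∀ (F' : CodeTuple S) (hF' : F'.IsRegular μ),
      F'.IsExtendable → F'.IsDelayDecodable k → F.avgLength μ hF ≤ F'.avgLength μ hF'

end CodeTuple

/-! Suppose a word d with |d| ≥ k can be produced from a recurrent table i, but dβ cannot. The bit
after d is then forced, carries no information, and can be dropped. A transducer whose states pair a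
table with the part of d still to be read outputs the sequences of F with that bit left out;
whenever it would enter i with no pattern pending, it starts the pattern again.

Dropping the bit preserves `Separates`, since a forced bit can be reinserted into both of two
agreeing sequences (`exists_common_prefix_of_deleteAfter`). Restarting preserves it as well:
deletion only affects what lies beyond the first |d| ≥ k bits, and a transition may be rerouted to
any state with the same producible words of at most k bits (`Separates.redirect`).

The new code projects onto F, its codewords are nowhere longer and are shorter somewhere in the
recurrent part, so `avgLength_lt_of_cover` contradicts optimality. Hence every producible word of
length at least k extends by either bit, and induction on the length finishes. -/

namespace CodeTuple

/-! ### Transducers with arbitrary state space -/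

section Automaton

variable {S Q : Type*}

/-- The codeword sequence produced from the state `q` of a transducer with an arbitrary
state space. -/
def encode (f : Q → S → List Bool) (τ : Q → S → Q) : Q → List S → List Bool
  | _, [] => []
  | q, s :: x => f q s ++ encode f τ (τ q s) x

/-- The state reached from the state `q`. -/
def run (τ : Q → S → Q) : Q → List S → Q
  | q, [] => q
  | q, s :: x => run τ (τ q s) x

/-- Two codeword sequences that start with different symbols separate within `k` bits after the
codeword of the first symbol. -/
def Separates (f : Q → S → List Bool) (τ : Q → S → Q) (k : ℕ) : Prop :=
  ∀ (q : Q) (s s' : S) (x x' : List S) (p : List Bool), s ≠ s' →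
    p <+: encode f τ q (s :: x) → p <+: encode f τ q (s' :: x') → p.length < (f q s).length + k

/-- From every state some non-empty codeword sequence is produced. -/
def Productive (f : Q → S → List Bool) (τ : Q → S → Q) : Prop :=
  ∀ q, ∃ x, encode f τ q x ≠ []

theorem encode_append (f : Q → S → List Bool) (τ : Q → S → Q) (x y : List S) (q : Q) :
    encode f τ q (x ++ y) = encode f τ q x ++ encode f τ (run τ q x) y := by
  induction x generalizing q with
  | nil => rfl
  | cons s x ih => simp [encode, run, ih]

theorem run_append (τ : Q → S → Q) (x y : List S) (q : Q) :
    run τ q (x ++ y) = run τ (run τ q x) y := by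
  induction x generalizing q with
  | nil => rfl
  | cons s x ih => simp [run, ih]

theorem Productive.exists_length {f : Q → S → List Bool} {τ : Q → S → Q} (h : Productive f τ)
    (n : ℕ) (q : Q) : ∃ x, n ≤ (encode f τ q x).length := by
  induction n with
  | zero => exact ⟨[], Nat.zero_le _⟩
  | succ n ih =>
    obtain ⟨x, hx⟩ := ih
    obtain ⟨y, hy⟩ := h (run τ q x)
    refine ⟨x ++ y, ?_⟩
    have := List.length_pos_of_ne_nil hy
    rw [encode_append, List.length_append]
    omega

theorem Productive.exists_append_length {f : Q → S → List Bool} {τ : Q → S → Q}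
    (h : Productive f τ) (n : ℕ) (q : Q) (x : List S) :
    ∃ y, n ≤ (encode f τ q (x ++ y)).length := by
  obtain ⟨y, hy⟩ := h.exists_length n (run τ q x)
  refine ⟨y, ?_⟩
  rw [encode_append, List.length_append]
  omega

theorem prefix_append_cases {c u w : List Bool} (h : c <+: u ++ w) :
    c <+: u ∨ ∃ c', c = u ++ c' ∧ c' <+: w := by
  rcases List.prefix_or_prefix_of_prefix h (List.prefix_append u w) with h1 | ⟨c', rfl⟩
  · exact Or.inl h1
  · exact Or.inr ⟨c', rfl, (List.prefix_append_right_inj u).1 h⟩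

/-! ### Rerouting transitions between states with the same k-bit futures -/

section Redirect

variable {f : Q → S → List Bool} {τ τ' : Q → S → Q} {k : ℕ}

theorem exists_prefix_encode_of_redirect
    (hτ : ∀ q s c, c.length ≤ k →
      ((∃ x, c <+: encode f τ (τ' q s) x) ↔ ∃ x, c <+: encode f τ (τ q s) x))
    (x : List S) (q : Q) (c : List Bool) (hc : c.length ≤ k) (h : c <+: encode f τ' q x) :
    ∃ y, c <+: encode f τ q y := by
  induction x generalizing q c with
  | nil => exact ⟨[], h⟩
  | cons s x ih =>
    rcases prefix_append_cases h with h1 | ⟨c', rfl, h1⟩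
    · exact ⟨[s], by simpa [encode] using h1⟩
    · rw [List.length_append] at hc
      obtain ⟨y, hy⟩ := (hτ q s c' (by omega)).1 (ih _ c' (by omega) h1)
      exact ⟨s :: y, (List.prefix_append_right_inj _).2 hy⟩

theorem exists_prefix_encode_cons_of_redirect
    (hτ : ∀ q s c, c.length ≤ k →
      ((∃ x, c <+: encode f τ (τ' q s) x) ↔ ∃ x, c <+: encode f τ (τ q s) x))
    (x : List S) (q : Q) (s : S) (c : List Bool) (hc : c.length ≤ (f q s).length + k)
    (h : c <+: encode f τ' q (s :: x)) : ∃ y, c <+: encode f τ q (s :: y) := by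
  rcases prefix_append_cases h with h1 | ⟨c', rfl, h1⟩
  · exact ⟨[], h1.trans (List.prefix_append _ _)⟩
  · rw [List.length_append] at hc
    obtain ⟨y, hy⟩ := (hτ q s c' (by omega)).1
      (exists_prefix_encode_of_redirect hτ x _ c' (by omega) h1)
    exact ⟨y, (List.prefix_append_right_inj _).2 hy⟩

theorem Separates.redirect (hsep : Separates f τ k)
    (hτ : ∀ q s c, c.length ≤ k →
      ((∃ x, c <+: encode f τ (τ' q s) x) ↔ ∃ x, c <+: encode f τ (τ q s) x)) :
    Separates f τ' k := by
  have key : ∀ (q : Q) (s s' : S) (x x' : List S) (p : List Bool), s ≠ s' →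
      p <+: encode f τ' q (s :: x) → p <+: encode f τ' q (s' :: x') →
      (f q s).length ≤ (f q s').length → p.length < (f q s).length + k := by
    intro q s s' x x' p hs h h' hle
    by_contra hp
    -- Cut here, p extends at most k bits beyond either codeword, because `f q s` is the shorter
    -- one; futures of at most k bits are all that rerouting preserves.
    have ht : (p.take ((f q s).length + k)).length = (f q s).length + k := by
      rw [List.length_take]; omega
    obtain ⟨y, hy⟩ := exists_prefix_encode_cons_of_redirect hτ x q s _ ht.le
      ((List.take_prefix _ _).trans h)
    obtain ⟨y', hy'⟩ := exists_prefix_encode_cons_of_redirect hτ x' q s' _ (by omega)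
      ((List.take_prefix ((f q s).length + k) _).trans h')
    have := hsep q s s' y y' _ hs hy hy'
    omega
  intro q s s' x x' p hs h h'
  rcases le_total (f q s).length (f q s').length with hle | hle
  · exact key q s s' x x' p hs h h' hle
  · have := key q s' s x' x p hs.symm h' h hle
    omega

/-- Rerouting could create a cycle of empty codewords. But an empty codeword strictly shrinks the
set of producible k-bit words: those beginning with another symbol are lost, by separation. The set
is finite and the rerouted target has the same one, so empty codewords cannot go on forever. -/
theorem Productive.redirect [Nontrivial S] (hprod : Productive f τ) (hsep : Separates f τ k)
    (hτ : ∀ q s c, c.length ≤ k →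
      ((∃ x, c <+: encode f τ (τ' q s) x) ↔ ∃ x, c <+: encode f τ (τ q s) x)) :
    Productive f τ' := by
  let A : Q → Set (List Bool) := fun q => {c | c.length = k ∧ ∃ x, c <+: encode f τ q x}
  have hfin : ∀ q, (A q).Finite := fun q =>
    (List.finite_length_eq Bool k).subset fun c hc => hc.1
  intro q
  induction hn : (A q).ncard using Nat.strong_induction_on generalizing q with
  | _ n ih =>
    obtain ⟨s, s', hs⟩ := exists_pair_ne S
    by_cases hf : f q s = []
    · have hA : A (τ' q s) = A (τ q s) := by
        ext c
        exact and_congr_right fun hc => hτ q s c hc.le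
      have hlt : (A (τ' q s)).ncard < (A q).ncard := by
        rw [hA]
        refine Set.ncard_lt_ncard ⟨?_, ?_⟩ (hfin q)
        · rintro c ⟨hc, x, hx⟩
          exact ⟨hc, s :: x, by simpa [encode, hf] using hx⟩
        · intro hsub
          obtain ⟨y, hy⟩ := hprod.exists_append_length k q [s']
          have hl : ((encode f τ q ([s'] ++ y)).take k).length = k := by
            rw [List.length_take]; omega
          obtain ⟨-, x, hx⟩ := hsub ⟨hl, _, List.take_prefix _ _⟩
          have := hsep q s s' x y _ hs (by simpa [encode, hf] using hx) (List.take_prefix k _)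
          simp only [List.singleton_append] at hl
          rw [hf, hl] at this
          simp at this
      obtain ⟨x, hx⟩ := ih _ (hn ▸ hlt) (τ' q s) rfl
      exact ⟨s :: x, by simpa [encode, hf] using hx⟩
    · exact ⟨[s], by simpa [encode] using hf⟩

end Redirect

/-! ### Deleting a forced bit -/

section Deletion

/-- Delete from a bit sequence that starts with `d` the bit that follows `d`. -/
def deleteAfter : List Bool → List Bool → List Bool
  | _, [] => []
  | [], _ :: w => w
  | a :: d, b :: w => if a = b then b :: deleteAfter d w else b :: w

/-- What is left of the pattern `d` after reading a bit sequence; `none` if `d` has been passed or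
missed. -/
def residual : List Bool → List Bool → Option (List Bool)
  | d, [] => some d
  | [], _ :: _ => none
  | a :: d, b :: w => if a = b then residual d w else none

/-- `deleteAfter` for an optional pattern. -/
def deleteAt : Option (List Bool) → List Bool → List Bool
  | none, w => w
  | some d, w => deleteAfter d w

/-- `residual` for an optional pattern. -/
def residualAt : Option (List Bool) → List Bool → Option (List Bool)
  | none, _ => none
  | some d, w => residual d w

theorem deleteAfter_append (d w w' : List Bool) :
    deleteAfter d (w ++ w') = deleteAfter d w ++ deleteAt (residual d w) w' := by
  induction w generalizing d with
  | nil => simp [deleteAfter, residual, deleteAt]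
  | cons b w ih =>
    cases d with
    | nil => simp [deleteAfter, residual, deleteAt]
    | cons a d =>
      by_cases h : a = b
      · simp [deleteAfter, residual, h, ih]
      · simp [deleteAfter, residual, h, deleteAt]

theorem deleteAt_append (o : Option (List Bool)) (w w' : List Bool) :
    deleteAt o (w ++ w') = deleteAt o w ++ deleteAt (residualAt o w) w' := by
  cases o with
  | none => rfl
  | some d => exact deleteAfter_append d w w'

theorem residualAt_append (o : Option (List Bool)) (w w' : List Bool) :
    residualAt o (w ++ w') = residualAt (residualAt o w) w' := by
  cases o with
  | none => rfl
  | some d =>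
    induction w generalizing d with
    | nil => simp [residualAt, residual]
    | cons b w ih =>
      cases d with
      | nil => simp [residualAt, residual]
      | cons a d =>
        by_cases h : a = b
        · simpa [residualAt, residual, h] using ih d
        · simp [residualAt, residual, h]

theorem append_eq_of_residual_eq_some {d w e : List Bool} (h : residual d w = some e) :
    w ++ e = d := by
  induction w generalizing d with
  | nil => simpa [residual, eq_comm] using h
  | cons b w ih =>
    cases d with
    | nil => simp [residual] at h
    | cons a d =>
      by_cases hab : a = b
      · simp only [residual, hab, if_true] at h
        simp [ih h, hab]
      · simp [residual, hab] at h

theorem residualAt_eq_none {o : Option (List Bool)} {w : List Bool}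
    (h : ∀ d ∈ o, d.length < w.length) : residualAt o w = none := by
  cases o with
  | none => rfl
  | some d =>
    by_contra hne
    obtain ⟨e, he⟩ := Option.ne_none_iff_exists'.1 hne
    have h1 := congrArg List.length (append_eq_of_residual_eq_some (d := d) he)
    have h2 := h d rfl
    rw [List.length_append] at h1
    omega

theorem length_deleteAfter_le (d w : List Bool) : (deleteAfter d w).length ≤ w.length := by
  induction w generalizing d with
  | nil => simp [deleteAfter]
  | cons b w ih =>
    cases d with
    | nil => simp [deleteAfter]
    | cons a d =>
      have := ih d
      by_cases h : a = b <;> simp [deleteAfter, h, this]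

theorem length_deleteAt_le (o : Option (List Bool)) (w : List Bool) :
    (deleteAt o w).length ≤ w.length := by
  cases o with
  | none => exact le_rfl
  | some d => exact length_deleteAfter_le d w

theorem length_le_deleteAfter (d w : List Bool) : w.length ≤ (deleteAfter d w).length + 1 := by
  induction w generalizing d with
  | nil => simp
  | cons b w ih =>
    cases d with
    | nil => simp [deleteAfter]
    | cons a d =>
      have := ih d
      by_cases h : a = b <;> simp [deleteAfter, h, this]

theorem length_le_deleteAt (o : Option (List Bool)) (w : List Bool) :
    w.length ≤ (deleteAt o w).length + 1 := by
  cases o with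
  | none => exact Nat.le_succ _
  | some d => exact length_le_deleteAfter d w

theorem deleteAfter_append_cons (d : List Bool) (b : Bool) (w : List Bool) :
    deleteAfter d (d ++ b :: w) = d ++ w := by
  induction d with
  | nil => rfl
  | cons a d ih => simp [deleteAfter, ih]

/-- The deleted bit has index |d|, so the first |d| bits stay in place. -/
theorem prefix_deleteAfter_iff {d c : List Bool} (w : List Bool) (h : c.length ≤ d.length)
    (hw : c.length < w.length) : c <+: deleteAfter d w ↔ c <+: w := by
  induction c generalizing d w with
  | nil => simp
  | cons a c ih =>
    obtain ⟨b, d, rfl⟩ := List.exists_cons_of_length_pos (l := d) (by simp at h; omega)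
    obtain ⟨b', w, rfl⟩ := List.exists_cons_of_length_pos (l := w) (by simp at hw; omega)
    simp only [List.length_cons] at h hw
    by_cases hb : b = b'
    · simp [deleteAfter, hb, List.cons_prefix_cons, ih (d := d) w (by omega) (by omega)]
    · simp [deleteAfter, hb]

/-- If the bit that follows `d` is forced, then a common prefix after deletion comes from a common
prefix before deletion, which is longer if a codeword `u` has lost a bit. -/
theorem exists_common_prefix_of_deleteAfter {β : Bool} {d p w w' : List Bool}
    (hd : ¬ d ++ [β] <+: w) (hd' : ¬ d ++ [β] <+: w')
    (hw : p.length < w.length) (hw' : p.length < w'.length)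
    (hp : p <+: deleteAfter d w) (hp' : p <+: deleteAfter d w') :
    ∃ c, c <+: w ∧ c <+: w' ∧ ∀ u k, u <+: w → (deleteAfter d u).length + k ≤ p.length →
      u.length + k ≤ c.length := by
  induction d generalizing p w w' with
  | nil =>
    obtain ⟨b, w, rfl⟩ := List.exists_cons_of_length_pos (l := w) (by omega)
    obtain ⟨b', w', rfl⟩ := List.exists_cons_of_length_pos (l := w') (by omega)
    -- Both bits differ from β, and only one such bit exists; it is put back in front of p.
    have hb : b = b' := by
      simp [List.cons_prefix_cons] at hd hd'
      cases b <;> cases b' <;> cases β <;> simp_all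
    subst hb
    refine ⟨b :: p, ?_, ?_, ?_⟩
    · simpa [deleteAfter, List.cons_prefix_cons] using hp
    · simpa [deleteAfter, List.cons_prefix_cons] using hp'
    · intro u k _ hk
      have := length_le_deleteAfter [] u
      rw [List.length_cons]
      omega
  | cons a d ih =>
    obtain ⟨b, w, rfl⟩ := List.exists_cons_of_length_pos (l := w) (by omega)
    obtain ⟨b', w', rfl⟩ := List.exists_cons_of_length_pos (l := w') (by omega)
    cases p with
    | nil =>
      refine ⟨[], List.nil_prefix, List.nil_prefix, ?_⟩
      -- The first bit of u survives deletion because the pattern is non-empty; so u is empty and k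
      -- = 0.
      intro u k _ hk
      cases u with
      | nil => simpa [deleteAfter] using hk
      | cons e u => by_cases h : a = e <;> simp [deleteAfter, h] at hk
    | cons c p =>
      have hb : c = b := by
        by_cases h : a = b <;> simp [deleteAfter, h, List.cons_prefix_cons] at hp <;> exact hp.1
      have hb' : c = b' := by
        by_cases h : a = b' <;> simp [deleteAfter, h, List.cons_prefix_cons] at hp' <;> exact hp'.1
      subst hb hb'
      by_cases h : a = c
      · subst h
        simp only [deleteAfter, if_true, List.cons_prefix_cons, true_and, List.cons_append,
          List.length_cons] at hd hd' hw hw' hp hp'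
        obtain ⟨e, he, he', H⟩ := ih hd hd' (by omega) (by omega) hp hp'
        refine ⟨a :: e, by simpa [List.cons_prefix_cons], by simpa [List.cons_prefix_cons], ?_⟩
        intro u k hu hk
        cases u with
        | nil =>
          -- The common head accounts for one of the k bits; if k = 0 the truncated subtraction is
          -- harmless.
          have := H [] (k - 1) List.nil_prefix (by simp [deleteAfter] at hk ⊢; omega)
          simp at this ⊢
          omega
        | cons g u =>
          obtain ⟨rfl, hu'⟩ := List.cons_prefix_cons.1 hu
          have := H u k hu' (by simp [deleteAfter] at hk; omega)
          simp only [List.length_cons]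
          omega
      -- The pattern is missed by both sequences, so nothing is deleted from either.
      · simp only [deleteAfter, h, if_false] at hp hp'
        refine ⟨c :: p, hp, hp', ?_⟩
        intro u k hu hk
        cases u with
        | nil => simpa [deleteAfter] using hk
        | cons g u =>
          obtain ⟨rfl, hu⟩ := List.cons_prefix_cons.1 hu
          simpa [deleteAfter, h] using hk

theorem exists_common_prefix_of_deleteAt {β : Bool} {o : Option (List Bool)} {p w w' : List Bool}
    (hd : ∀ d ∈ o, ¬ d ++ [β] <+: w) (hd' : ∀ d ∈ o, ¬ d ++ [β] <+: w')
    (hw : p.length < w.length) (hw' : p.length < w'.length)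
    (hp : p <+: deleteAt o w) (hp' : p <+: deleteAt o w') :
    ∃ c, c <+: w ∧ c <+: w' ∧ ∀ u k, u <+: w → (deleteAt o u).length + k ≤ p.length →
      u.length + k ≤ c.length := by
  cases o with
  | none => exact ⟨p, hp, hp', fun u k _ h => h⟩
  | some d => exact exists_common_prefix_of_deleteAfter (hd d rfl) (hd' d rfl) hw hw' hp hp'

/-! ### The transducer that deletes the forced bit -/

variable (f : Q → S → List Bool) (τ : Q → S → Q) (d₀ : List Bool) (β : Bool)

/-- States with an optional pattern, a suffix of `d₀` that is never followed by the bit `β`. -/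
abbrev PatternState : Type _ :=
  {q : Q × Option (List Bool) //
    ∀ d ∈ q.2, d <:+ d₀ ∧ ∀ x, ¬ d ++ [β] <+: encode f τ q.1 x}

theorem finite_patternState [Finite Q] : Finite (PatternState f τ d₀ β) := by
  have h1 : {d : List Bool | d <:+ d₀}.Finite := by
    refine (List.finite_toSet d₀.tails).subset fun d hd => ?_
    simpa using hd
  have h2 : {o : Option (List Bool) | ∀ d ∈ o, d <:+ d₀}.Finite := by
    refine ((h1.image some).union (Set.finite_singleton none)).subset fun o ho => ?_
    cases o with
    | none => simp
    | some d => exact Or.inl ⟨d, ho d rfl, rfl⟩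
  refine Set.Finite.subset (Set.finite_univ.prod h2) ?_
  exact fun q hq => ⟨trivial, fun d hd => (hq d hd).1⟩

/-- The code tables after deletion of the forced bit. -/
def deletedTable (q : PatternState f τ d₀ β) (s : S) : List Bool :=
  deleteAt q.1.2 (f q.1.1 s)

/-- The transitions that keep track of the pattern. -/
def deletedNext (q : PatternState f τ d₀ β) (s : S) : PatternState f τ d₀ β :=
  ⟨(τ q.1.1 s, residualAt q.1.2 (f q.1.1 s)), by
    obtain ⟨⟨q, o⟩, hq⟩ := q
    intro e he
    cases o with
    | none => cases he
    | some d =>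
      have hde := append_eq_of_residual_eq_some (d := d) he
      obtain ⟨h1, h2⟩ := hq d rfl
      refine ⟨(hde ▸ List.suffix_append _ _ : e <:+ d).trans h1, fun x hx => h2 (s :: x) ?_⟩
      rw [← hde, List.append_assoc]
      exact (List.prefix_append_right_inj _).2 hx⟩

variable {f τ d₀ β}

theorem encode_deleted (x : List S) (q : PatternState f τ d₀ β) :
    encode (deletedTable f τ d₀ β) (deletedNext f τ d₀ β) q x =
      deleteAt q.1.2 (encode f τ q.1.1 x) := by
  induction x generalizing q with
  | nil =>
    obtain ⟨⟨q, o⟩, hq⟩ := q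
    cases o <;> simp [encode, deleteAt, deleteAfter]
  | cons s x ih => simp [encode, ih, deleteAt_append, deletedTable, deletedNext]

theorem run_deleted (x : List S) (q : PatternState f τ d₀ β) :
    (run (deletedNext f τ d₀ β) q x).1 =
      (run τ q.1.1 x, residualAt q.1.2 (encode f τ q.1.1 x)) := by
  induction x generalizing q with
  | nil =>
    obtain ⟨⟨q, o⟩, hq⟩ := q
    cases o <;> simp [run, encode, residualAt, residual]
  | cons s x ih => simp [run, encode, ih, residualAt_append, deletedNext]

theorem Productive.deleted (hprod : Productive f τ) :
    Productive (deletedTable f τ d₀ β) (deletedNext f τ d₀ β) := by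
  intro q
  -- At most one bit is lost, so two bits of output suffice.
  obtain ⟨x, hx⟩ := hprod.exists_length 2 q.1.1
  refine ⟨x, fun h => ?_⟩
  rw [encode_deleted] at h
  have := length_le_deleteAt q.1.2 (encode f τ q.1.1 x)
  rw [h] at this
  simp at this
  omega

theorem Separates.deleted {k : ℕ} (hsep : Separates f τ k) (hprod : Productive f τ) :
    Separates (deletedTable f τ d₀ β) (deletedNext f τ d₀ β) k := by
  intro q s s' x x' p hs h h'
  -- Both sequences are prolonged past |p| so that the forced bit is present even when p ends just
  -- before it.
  obtain ⟨y, hy⟩ := hprod.exists_append_length (p.length + 1) q.1.1 (s :: x)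
  obtain ⟨y', hy'⟩ := hprod.exists_append_length (p.length + 1) q.1.1 (s' :: x')
  have hm : ∀ z y, p <+: encode (deletedTable f τ d₀ β) (deletedNext f τ d₀ β) q z →
      p <+: deleteAt q.1.2 (encode f τ q.1.1 (z ++ y)) := by
    intro z y hz
    rw [← encode_deleted, encode_append]
    exact hz.trans (List.prefix_append _ _)
  obtain ⟨c, hc, hc', H⟩ := exists_common_prefix_of_deleteAt
    (fun d hd => (q.2 d hd).2 _) (fun d hd => (q.2 d hd).2 _) hy hy' (hm _ y h) (hm _ y' h')
  by_contra hp
  have h1 := H (f q.1.1 s) k (List.prefix_append _ _) (not_lt.1 hp)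
  have h2 := hsep q.1.1 s s' _ _ c hs hc hc'
  omega

/-! ### Restarting the pattern at the state `i` -/

variable (i : Q) (hβ : ∀ x, ¬ d₀ ++ [β] <+: encode f τ i x)

/-- The state `i` without a pattern. -/
def plainState (f : Q → S → List Bool) (τ : Q → S → Q) (d₀ : List Bool) (β : Bool) (i : Q) :
    PatternState f τ d₀ β :=
  ⟨(i, none), fun _ h => by cases h⟩

/-- The state `i` with the whole pattern. -/
def startState : PatternState f τ d₀ β :=
  ⟨(i, some d₀), fun d h => by
    obtain rfl : d₀ = d := Option.some.inj h
    exact ⟨List.suffix_refl _, hβ⟩⟩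

open Classical in
/-- The transitions that start a new pattern whenever the state `i` is entered without one. -/
noncomputable def restartNext (q : PatternState f τ d₀ β) (s : S) : PatternState f τ d₀ β :=
  if deletedNext f τ d₀ β q s = plainState f τ d₀ β i then startState i hβ
  else deletedNext f τ d₀ β q s

theorem fst_restartNext (q : PatternState f τ d₀ β) (s : S) :
    (restartNext i hβ q s).1.1 = τ q.1.1 s := by
  unfold restartNext
  split_ifs with h
  · exact (congrArg (fun r => r.1.1) h).symm
  · rfl

theorem exists_prefix_startState_iff (hprod : Productive f τ) {c : List Bool}
    (hc : c.length ≤ d₀.length) :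
    (∃ x, c <+: encode (deletedTable f τ d₀ β) (deletedNext f τ d₀ β) (startState i hβ) x) ↔
      ∃ x, c <+: encode (deletedTable f τ d₀ β) (deletedNext f τ d₀ β)
        (plainState f τ d₀ β i) x := by
  simp only [encode_deleted]
  change (∃ x, c <+: deleteAfter d₀ (encode f τ i x)) ↔ ∃ x, c <+: encode f τ i x
  constructor
  · rintro ⟨x, hx⟩
    obtain ⟨y, hy⟩ := hprod.exists_append_length (c.length + 1) i x
    refine ⟨x ++ y, (prefix_deleteAfter_iff _ hc hy).1 ?_⟩
    rw [encode_append, deleteAfter_append]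
    exact hx.trans (List.prefix_append _ _)
  · rintro ⟨x, hx⟩
    obtain ⟨y, hy⟩ := hprod.exists_append_length (c.length + 1) i x
    refine ⟨x ++ y, (prefix_deleteAfter_iff _ hc hy).2 ?_⟩
    rw [encode_append]
    exact hx.trans (List.prefix_append _ _)

theorem exists_prefix_restartNext_iff (hprod : Productive f τ) (q : PatternState f τ d₀ β) (s : S)
    (c : List Bool) (hc : c.length ≤ d₀.length) :
    (∃ x, c <+: encode (deletedTable f τ d₀ β) (deletedNext f τ d₀ β)
        (restartNext i hβ q s) x) ↔
      ∃ x, c <+: encode (deletedTable f τ d₀ β) (deletedNext f τ d₀ β)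
        (deletedNext f τ d₀ β q s) x := by
  unfold restartNext
  split_ifs with h
  · rw [h]
    exact exists_prefix_startState_iff i hβ hprod hc
  · rfl

/-- The two runs agree until the first entry into the plain state, which is where the restart
happens. Since a restart takes place on a transition, the empty run is excluded. -/
theorem exists_run_restartNext_of_run_deletedNext {x : List S} (hx : x ≠ [])
    {q : PatternState f τ d₀ β} (h : run (deletedNext f τ d₀ β) q x = plainState f τ d₀ β i) :
    ∃ y, run (restartNext i hβ) q y = startState i hβ := by
  induction x generalizing q with
  | nil => exact absurd rfl hx
  | cons s x ih =>
    by_cases hs : deletedNext f τ d₀ β q s = plainState f τ d₀ β i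
    · exact ⟨[s], by simp [run, restartNext, hs]⟩
    · have hx' : x ≠ [] := by
        rintro rfl
        exact hs h
      obtain ⟨y, hy⟩ := ih hx' h
      exact ⟨s :: y, by simpa [run, restartNext, hs] using hy⟩

theorem exists_run_eq_startState [Nonempty S] (hprod : Productive f τ)
    (hi : ∀ q, ∃ x, run τ q x = i) (q : PatternState f τ d₀ β) :
    ∃ y, run (restartNext i hβ) q y = startState i hβ := by
  -- After more than |d₀| bits any pending pattern has been passed or missed. The extra symbol `s`
  -- makes the run non-empty.
  obtain ⟨x, hx⟩ := hprod.exists_length (d₀.length + 1) q.1.1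
  obtain ⟨s⟩ := ‹Nonempty S›
  obtain ⟨y, hy⟩ := hi (τ (run τ q.1.1 x) s)
  refine exists_run_restartNext_of_run_deletedNext i hβ (x := x ++ s :: y) (by simp)
    (Subtype.ext ?_)
  rw [run_deleted, run_append]
  refine Prod.ext hy (residualAt_eq_none fun d hd => ?_)
  have := (q.2 d hd).1.length_le
  rw [encode_append, List.length_append]
  omega

/-- A loss in total length occurs at some symbol. It precedes any entry into the plain state, after
which nothing would be deleted; up to there the restarting run is the same. -/
theorem exists_length_deletedTable_lt {x : List S} {q : PatternState f τ d₀ β}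
    (h : (encode (deletedTable f τ d₀ β) (deletedNext f τ d₀ β) q x).length <
      (encode f τ q.1.1 x).length) :
    ∃ y s, (deletedTable f τ d₀ β (run (restartNext i hβ) q y) s).length <
      (f (run (restartNext i hβ) q y).1.1 s).length := by
  induction x generalizing q with
  | nil => simp [encode] at h
  | cons s x ih =>
    by_cases hs : (deletedTable f τ d₀ β q s).length < (f q.1.1 s).length
    · exact ⟨[], s, hs⟩
    · simp only [encode, List.length_append] at h
      by_cases hp : deletedNext f τ d₀ β q s = plainState f τ d₀ β i
      · have h1 : τ q.1.1 s = i := congrArg (fun r => r.1.1) hp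
        rw [hp, encode_deleted, h1] at h
        simp only [plainState, deleteAt] at h
        omega
      · obtain ⟨y, t, hy⟩ := ih (q := deletedNext f τ d₀ β q s)
          (by change _ < (encode f τ (τ q.1.1 s) x).length; omega)
        exact ⟨s :: y, t, by simpa [run, restartNext, hp] using hy⟩

theorem exists_length_deletedTable_lt_of_prefix (hprod : Productive f τ)
    (hd : ∃ x, d₀ <+: encode f τ i x) :
    ∃ y s, (deletedTable f τ d₀ β (run (restartNext i hβ) (startState i hβ) y) s).length <
      (f (run (restartNext i hβ) (startState i hβ) y).1.1 s).length := by
  obtain ⟨x, w, hx⟩ := hd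
  obtain ⟨y, hy⟩ := hprod (run τ i x)
  refine exists_length_deletedTable_lt i hβ (x := x ++ y) ?_
  rw [encode_deleted]
  change (deleteAfter d₀ (encode f τ i (x ++ y))).length < (encode f τ i (x ++ y)).length
  rw [encode_append, ← hx, List.append_assoc]
  obtain ⟨b, v, hv⟩ := List.exists_cons_of_ne_nil (l := w ++ encode f τ (run τ i x) y)
    (by simp [hy])
  rw [hv, deleteAfter_append_cons]
  simp

end Deletion

end Automaton

/-! ### Stationary distributions and average length -/

section Stationary

variable {S : Type*} [Fintype S] (F : CodeTuple S) {μ : S → ℝ}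

theorem vecMul_transMatrix_dotProduct (v g : Fin F.size → ℝ) :
    ∑ j, Matrix.vecMul v (F.transMatrix μ) j * g j =
      ∑ i, v i * ∑ s, μ s * g (F.τ i s) := by
  simp only [Matrix.vecMul, dotProduct, transMatrix, Matrix.of_apply, Finset.sum_mul]
  rw [Finset.sum_comm]
  refine Finset.sum_congr rfl fun i _ => ?_
  simp only [mul_assoc, ← Finset.mul_sum]
  congr 1
  simp only [Finset.sum_filter, Finset.sum_mul]
  rw [Finset.sum_comm]
  refine Finset.sum_congr rfl fun s _ => ?_
  simp

/-- Tested against functions, invariance passes to image measures by substitution. -/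
theorem vecMul_transMatrix_eq_iff (v : Fin F.size → ℝ) :
    Matrix.vecMul v (F.transMatrix μ) = v ↔
      ∀ g : Fin F.size → ℝ, ∑ i, v i * ∑ s, μ s * g (F.τ i s) = ∑ i, v i * g i := by
  constructor
  · intro h g
    rw [← vecMul_transMatrix_dotProduct, h]
  · intro h
    ext j
    have := h (Pi.single j 1)
    rw [← vecMul_transMatrix_dotProduct] at this
    simpa [Pi.single_apply] using this

variable {F}

/-- The triangle inequality gives |v| ≤ |v|Q entrywise; both sides have the same total since the
rows of Q sum to 1, so equality holds throughout. -/
theorem abs_vecMul_transMatrix_eq (hμ : ∀ s, 0 < μ s) (hμ_sum : ∑ s, μ s = 1)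
    {v : Fin F.size → ℝ} (h : Matrix.vecMul v (F.transMatrix μ) = v) :
    Matrix.vecMul (fun i => |v i|) (F.transMatrix μ) = fun i => |v i| := by
  have hle : ∀ j ∈ Finset.univ, |v j| ≤ Matrix.vecMul (fun i => |v i|) (F.transMatrix μ) j := by
    intro j _
    conv_lhs => rw [← h]
    simp only [Matrix.vecMul, dotProduct, transMatrix, Matrix.of_apply]
    refine (Finset.abs_sum_le_sum_abs _ _).trans (Finset.sum_le_sum fun i _ => ?_)
    rw [abs_mul, abs_of_nonneg (Finset.sum_nonneg fun s _ => (hμ s).le)]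
  have hsum : ∑ j, |v j| = ∑ j, Matrix.vecMul (fun i => |v i|) (F.transMatrix μ) j := by
    have := vecMul_transMatrix_dotProduct F (μ := μ) (fun i => |v i|) 1
    simpa [hμ_sum] using this.symm
  ext j
  exact (((Finset.sum_eq_sum_iff_of_le hle).1 hsum) j (Finset.mem_univ j)).symm

theorem pos_run_of_pos (hμ : ∀ s, 0 < μ s) {v : Fin F.size → ℝ}
    (h : Matrix.vecMul v (F.transMatrix μ) = v) (hv : ∀ i, 0 ≤ v i) (x : List S)
    {i : Fin F.size} (hi : 0 < v i) : 0 < v (run F.τ i x) := by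
  induction x generalizing i with
  | nil => exact hi
  | cons s x ih =>
    refine ih ?_
    rw [← h]
    simp only [Matrix.vecMul, dotProduct, transMatrix, Matrix.of_apply]
    refine Finset.sum_pos' (fun j _ => mul_nonneg (hv j)
      (Finset.sum_nonneg fun s _ => (hμ s).le)) ⟨i, Finset.mem_univ i, mul_pos hi ?_⟩
    exact Finset.sum_pos (fun s _ => hμ s) ⟨s, by simp⟩

theorem exists_ne_zero_vecMul_transMatrix_eq (hμ_sum : ∑ s, μ s = 1) :
    ∃ v : Fin F.size → ℝ, v ≠ 0 ∧ Matrix.vecMul v (F.transMatrix μ) = v := by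
  have hdet : (F.transMatrix μ - 1).det = 0 := by
    -- Q fixes the all-ones column vector, so Q − 1 is singular and has a left null vector too.
    refine Matrix.exists_mulVec_eq_zero_iff.1 ⟨1, ?_, ?_⟩
    · intro h
      exact one_ne_zero (congrFun h ⟨0, F.size_pos⟩)
    · ext i
      have : ∑ j, ∑ s with F.τ i s = j, μ s = 1 := by
        rw [Finset.sum_fiberwise, hμ_sum]
      rw [Matrix.sub_mulVec, Matrix.one_mulVec]
      simpa [Matrix.mulVec, dotProduct, transMatrix, sub_eq_zero] using this
  obtain ⟨v, hv, h⟩ := Matrix.exists_vecMul_eq_zero_iff.2 hdet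
  exact ⟨v, hv, by simpa [Matrix.vecMul_sub, sub_eq_zero] using h⟩

theorem exists_isStationary_nonneg (hμ : ∀ s, 0 < μ s) (hμ_sum : ∑ s, μ s = 1) :
    ∃ π, F.IsStationary μ π ∧ ∀ i, 0 ≤ π i := by
  obtain ⟨v, hv, h⟩ := exists_ne_zero_vecMul_transMatrix_eq (F := F) hμ_sum
  have habs := abs_vecMul_transMatrix_eq hμ hμ_sum h
  have hpos : 0 < ∑ i, |v i| := by
    obtain ⟨i, hi⟩ := Function.ne_iff.1 hv
    exact Finset.sum_pos' (fun i _ => abs_nonneg _) ⟨i, Finset.mem_univ i, abs_pos.2 hi⟩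
  refine ⟨(∑ i, |v i|)⁻¹ • fun i => |v i|, ⟨?_, ?_⟩, fun i => ?_⟩
  · rw [Matrix.smul_vecMul, habs]
  · simp only [Pi.smul_apply, smul_eq_mul, ← Finset.mul_sum]
    exact inv_mul_cancel₀ hpos.ne'
  · exact mul_nonneg (inv_nonneg.2 hpos.le) (abs_nonneg _)

/-- If v ≠ 0, it has entries of both signs, so the non-negative invariant vectors |v| + v and |v| −
v are both non-zero. Positivity propagates along runs, making both positive at `i₀`, where one of
them must vanish. -/
theorem eq_zero_of_vecMul_transMatrix_eq (hμ : ∀ s, 0 < μ s) (hμ_sum : ∑ s, μ s = 1)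
    {i₀ : Fin F.size} (hi₀ : ∀ i, ∃ x, run F.τ i x = i₀) {v : Fin F.size → ℝ}
    (h : Matrix.vecMul v (F.transMatrix μ) = v) (hsum : ∑ i, v i = 0) : v = 0 := by
  have habs := abs_vecMul_transMatrix_eq hμ hμ_sum h
  by_contra hv
  have hplus : Matrix.vecMul ((fun i => |v i|) + v) (F.transMatrix μ) = (fun i => |v i|) + v := by
    rw [Matrix.add_vecMul, habs, h]
  have hminus : Matrix.vecMul ((fun i => |v i|) - v) (F.transMatrix μ) = (fun i => |v i|) - v := by
    rw [Matrix.sub_vecMul, habs, h]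
  have hne : ∃ i ∈ (Finset.univ : Finset (Fin F.size)), v i ≠ 0 := by
    obtain ⟨i, hi⟩ := Function.ne_iff.1 hv
    exact ⟨i, Finset.mem_univ i, hi⟩
  obtain ⟨a, -, ha⟩ := Finset.exists_pos_of_sum_zero_of_exists_nonzero v hsum hne
  obtain ⟨b, -, hb⟩ := Finset.exists_pos_of_sum_zero_of_exists_nonzero (s := Finset.univ)
    (fun i => -v i) (by simp [hsum]) (by simpa using hne)
  obtain ⟨x, hx⟩ := hi₀ a
  obtain ⟨y, hy⟩ := hi₀ b
  have h1 := pos_run_of_pos hμ hplus (fun i => by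
    have := neg_abs_le (v i); simp only [Pi.add_apply]; linarith) x (i := a) (by
    simp only [Pi.add_apply]; have := abs_nonneg (v a); linarith)
  have h2 := pos_run_of_pos hμ hminus (fun i => by
    have := le_abs_self (v i); simp only [Pi.sub_apply]; linarith) y (i := b) (by
    simp only [Pi.sub_apply]; have := abs_nonneg (v b); linarith)
  rw [hx] at h1
  rw [hy] at h2
  simp only [Pi.add_apply, Pi.sub_apply] at h1 h2
  rcases abs_cases (v i₀) with h3 | h3 <;> linarith

theorem isRegular_of_exists_run (hμ : ∀ s, 0 < μ s) (hμ_sum : ∑ s, μ s = 1)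
    {i₀ : Fin F.size} (hi₀ : ∀ i, ∃ x, run F.τ i x = i₀) : F.IsRegular μ := by
  obtain ⟨π, hπ, -⟩ := exists_isStationary_nonneg (F := F) hμ hμ_sum
  refine ⟨π, hπ, fun π' hπ' => sub_eq_zero.1 ?_⟩
  refine eq_zero_of_vecMul_transMatrix_eq hμ hμ_sum hi₀ ?_ ?_
  · rw [Matrix.sub_vecMul, hπ.1, hπ'.1]
  · simp [hπ.2, hπ'.2]

theorem stationaryDist_eq {h : F.IsRegular μ} {π : Fin F.size → ℝ} (hπ : F.IsStationary μ π) :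
    F.stationaryDist μ h = π :=
  (h.choose_spec.2 π hπ).symm

/-- If the tables of `F'` cover those of `F` compatibly with the transitions, with codewords that
are no longer, and shorter somewhere in the recurrent part, then `F'` has the smaller average
codeword length. -/
theorem avgLength_lt_of_cover (hμ : ∀ s, 0 < μ s) (hμ_sum : ∑ s, μ s = 1) {F' : CodeTuple S}
    (h : F.IsRegular μ) (h' : F'.IsRegular μ) (p : Fin F'.size → Fin F.size)
    (hp : ∀ i s, p (F'.τ i s) = F.τ (p i) s)
    (hle : ∀ i s, (F'.f i s).length ≤ (F.f (p i) s).length)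
    {i₀ : Fin F'.size} (hi₀ : ∀ i, ∃ x, run F'.τ i x = i₀)
    (hlt : ∃ x s, (F'.f (run F'.τ i₀ x) s).length < (F.f (p (run F'.τ i₀ x)) s).length) :
    F'.avgLength μ h' < F.avgLength μ h := by
  obtain ⟨π, hπ, hnn⟩ := exists_isStationary_nonneg (F := F') hμ hμ_sum
  have hpush : ∀ g : Fin F.size → ℝ,
      ∑ j, (∑ i with p i = j, π i) * g j = ∑ i, π i * g (p i) := by
    intro g
    simp only [Finset.sum_filter, Finset.sum_mul]
    rw [Finset.sum_comm]
    refine Finset.sum_congr rfl fun i _ => ?_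
    simp
  -- The image of π under the projection is stationary for F, hence is the stationary distribution
  -- of F by uniqueness. Both average lengths thus become sums over π.
  have hstat : F.IsStationary μ fun j => ∑ i with p i = j, π i := by
    refine ⟨(vecMul_transMatrix_eq_iff F _).2 fun g => ?_, ?_⟩
    · refine (hpush fun j => ∑ s, μ s * g (F.τ j s)).trans (Eq.trans ?_ (hpush g).symm)
      simpa [hp] using (vecMul_transMatrix_eq_iff F' π).1 hπ.1 (fun i => g (p i))
    · simpa [hπ.2] using hpush 1
  rw [avgLength, avgLength, stationaryDist_eq hπ, stationaryDist_eq hstat, hpush]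
  have hpos : 0 < π i₀ := by
    obtain ⟨a, -, ha⟩ : ∃ a ∈ Finset.univ, 0 < π a := by
      refine Finset.exists_lt_of_sum_lt (f := fun _ => (0 : ℝ)) ?_
      simp [hπ.2]
    obtain ⟨x, hx⟩ := hi₀ a
    exact hx ▸ pos_run_of_pos hμ hπ.1 hnn x ha
  have hterm : ∀ i s, ((F'.f i s).length : ℝ) * μ s ≤ ((F.f (p i) s).length : ℝ) * μ s :=
    fun i s => mul_le_mul_of_nonneg_right (by exact_mod_cast hle i s) (hμ s).le
  obtain ⟨x, s, hs⟩ := hlt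
  refine Finset.sum_lt_sum (fun i _ => mul_le_mul_of_nonneg_left
    (Finset.sum_le_sum fun s _ => hterm i s) (hnn i)) ⟨run F'.τ i₀ x, Finset.mem_univ _, ?_⟩
  refine mul_lt_mul_of_pos_left (Finset.sum_lt_sum (fun s _ => hterm _ s)
    ⟨s, Finset.mem_univ s, ?_⟩) (pos_run_of_pos hμ hπ.1 hnn x hpos)
  exact mul_lt_mul_of_pos_right (by exact_mod_cast hs) (hμ s)

end Stationary

/-! ### Translation between code-tuples and transducers -/

section Bridge

variable {S : Type*}

theorem fStar_eq_encode (F : CodeTuple S) (i : Fin F.size) (x : List S) :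
    F.fStar i x = encode F.f F.τ i x := by
  induction x generalizing i with
  | nil => rfl
  | cons s x ih => simp [fStar, encode, ih]

theorem τStar_eq_run (F : CodeTuple S) (i : Fin F.size) (x : List S) :
    F.τStar i x = run F.τ i x := by
  induction x generalizing i with
  | nil => rfl
  | cons s x ih => simp [τStar, run, ih]

theorem mem_pref_nil_iff [Nonempty S] (F : CodeTuple S) (k : ℕ) (i : Fin F.size) (c : List Bool) :
    c ∈ F.pref k i [] ↔ c.length = k ∧ ∃ x, c <+: encode F.f F.τ i x := by
  simp only [pref, Set.mem_ofPred_eq, fStar_eq_encode, List.nil_append, List.nil_prefix, and_true]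
  refine and_congr_right fun _ => ⟨fun ⟨s, x, h⟩ => ⟨_, h⟩, fun ⟨x, h⟩ => ?_⟩
  cases x with
  | nil =>
    obtain ⟨s⟩ := ‹Nonempty S›
    exact ⟨s, [], h.trans List.nil_prefix⟩
  | cons s x => exact ⟨s, x, h⟩

theorem mem_prefStar_nil_iff [Nonempty S] (F : CodeTuple S) (i : Fin F.size) (c : List Bool) :
    c ∈ F.prefStar i [] ↔ ∃ x, c <+: encode F.f F.τ i x := by
  simp [prefStar, mem_pref_nil_iff]

theorem isExtendable_iff [Nonempty S] (F : CodeTuple S) :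
    F.IsExtendable ↔ Productive F.f F.τ := by
  refine forall_congr' fun i => ⟨?_, ?_⟩
  · rintro ⟨c, hc⟩
    obtain ⟨hc, x, hx⟩ := (mem_pref_nil_iff F 1 i c).1 hc
    refine ⟨x, fun h => ?_⟩
    rw [h, List.prefix_nil] at hx
    simp [hx] at hc
  · rintro ⟨x, hx⟩
    refine ⟨(encode F.f F.τ i x).take 1, (mem_pref_nil_iff F 1 i _).2 ⟨?_, x, List.take_prefix _ _⟩⟩
    have := List.length_pos_of_ne_nil hx
    rw [List.length_take]
    omega

theorem IsDelayDecodable.separates [Nonempty S] {F : CodeTuple S} {k : ℕ}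
    (h : F.IsDelayDecodable k) : Separates F.f F.τ k := by
  have key : ∀ (q : Fin F.size) (s s' : S) (x x' : List S) (p : List Bool), s ≠ s' →
      p <+: encode F.f F.τ q (s :: x) → p <+: encode F.f F.τ q (s' :: x') →
      F.f q s <+: F.f q s' → p.length < (F.f q s).length + k := by
    intro q s s' x x' p hs hp hp' hf
    by_contra hlen
    rcases prefix_append_cases ((List.take_prefix ((F.f q s).length + k) p).trans hp)
      with hc | ⟨c, hc, hcx⟩
    · have h1 := hc.length_le
      rw [List.length_take] at h1
      -- A word of |f q s| + k bits fits inside `f q s` only if k = 0; the decodability conditions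
      -- then fail already through the empty word.
      have hk : k = 0 := by omega
      subst hk
      have hc' : F.f q s = F.f q s' ∨ F.f q s ≠ F.f q s' := em _
      have hmem : ∀ j : Fin F.size, [] ∈ F.pref 0 j [] := fun j =>
        (mem_pref_nil_iff F 0 j []).2 ⟨rfl, [], List.nil_prefix⟩
      rcases hc' with he | he
      · exact (h.2 q s s' hs he).le ⟨hmem _, hmem _⟩
      · refine (h.1 q s).le ⟨hmem _, rfl, s', [], ?_, hf, he⟩
        simpa [fStar] using hf
    · have hcl : c.length = k := by
        have := congrArg List.length hc
        rw [List.length_take, List.length_append] at this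
        omega
      have hcp : F.f q s ++ c <+: encode F.f F.τ q (s' :: x') :=
        hc ▸ (List.take_prefix _ _).trans hp'
      have hmem : c ∈ F.pref k (F.τ q s) [] := (mem_pref_nil_iff F k _ c).2 ⟨hcl, x, hcx⟩
      by_cases he : F.f q s = F.f q s'
      · refine (h.2 q s s' hs he).le ⟨hmem, (mem_pref_nil_iff F k _ c).2 ⟨hcl, x', ?_⟩⟩
        rw [he] at hcp
        exact (List.prefix_append_right_inj _).1 hcp
      · refine (h.1 q s).le ⟨hmem, hcl, s', x', ?_, hf, he⟩
        rwa [fStar_eq_encode]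
  intro q s s' x x' p hs hp hp'
  by_contra hlen
  have h1 : F.f q s <+: p :=
    List.prefix_of_prefix_length_le (List.prefix_append _ _) hp (by omega)
  rcases List.prefix_or_prefix_of_prefix (h1.trans hp') (List.prefix_append (F.f q s') _)
    with h2 | h2
  · exact hlen (key q s s' x x' p hs hp hp' h2)
  · have := key q s' s x' x p hs.symm hp' hp h2
    have := h2.length_le
    omega

theorem isDelayDecodable_of_separates [Nonempty S] {F : CodeTuple S} {k : ℕ}
    (h : Separates F.f F.τ k) : F.IsDelayDecodable k := by
  refine ⟨fun i s => Set.eq_empty_iff_forall_notMem.2 ?_,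
    fun i s s' hs hf => Set.eq_empty_iff_forall_notMem.2 ?_⟩
  · rintro c ⟨hc, hcl, s', x', hx', -, hne⟩
    obtain ⟨-, x, hx⟩ := (mem_pref_nil_iff F k _ c).1 hc
    rw [fStar_eq_encode] at hx'
    have hs : s ≠ s' := by
      rintro rfl
      exact hne rfl
    have := h i s s' x x' _ hs ((List.prefix_append_right_inj _).2 hx) hx'
    rw [List.length_append] at this
    omega
  · rintro c ⟨hc, hc'⟩
    obtain ⟨hcl, x, hx⟩ := (mem_pref_nil_iff F k _ c).1 hc
    obtain ⟨-, x', hx'⟩ := (mem_pref_nil_iff F k _ c).1 hc'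
    have := h i s s' x x' (F.f i s ++ c) hs ((List.prefix_append_right_inj _).2 hx)
      (hf ▸ (List.prefix_append_right_inj _).2 hx')
    rw [List.length_append] at this
    omega

variable {Q Q' : Type*}

theorem encode_equiv (e : Q ≃ Q') (f : Q → S → List Bool) (τ : Q → S → Q) (x : List S) (a : Q') :
    encode (fun a => f (e.symm a)) (fun a s => e (τ (e.symm a) s)) a x =
      encode f τ (e.symm a) x := by
  induction x generalizing a with
  | nil => rfl
  | cons s x ih => simp [encode, ih]

theorem run_equiv (e : Q ≃ Q') (τ : Q → S → Q) (x : List S) (a : Q') :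
    run (fun a s => e (τ (e.symm a) s)) a x = e (run τ (e.symm a) x) := by
  induction x generalizing a with
  | nil => simp [run]
  | cons s x ih => simp [run, ih]

/-- The code-tuple of a transducer with a finite state space. -/
noncomputable def ofStates (Q : Type*) [Finite Q] [Nonempty Q] (f : Q → S → List Bool)
    (τ : Q → S → Q) : CodeTuple S where
  size := Nat.card Q
  size_pos := Nat.card_pos
  f a := f ((Finite.equivFin Q).symm a)
  τ a s := Finite.equivFin Q (τ ((Finite.equivFin Q).symm a) s)

/-- An optimal code-tuple is not improved by a separating transducer that covers it. -/
theorem IsOptimal.false_of_cover [Fintype S] [Nonempty S] {μ : S → ℝ} (hμ : ∀ s, 0 < μ s)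
    (hμ_sum : ∑ s, μ s = 1) {k : ℕ} {F : CodeTuple S} (hF : F.IsOptimal μ k) [Finite Q]
    {f : Q → S → List Bool} {τ : Q → S → Q} (hsep : Separates f τ k) (hprod : Productive f τ)
    (p : Q → Fin F.size) (hp : ∀ q s, p (τ q s) = F.τ (p q) s)
    (hle : ∀ q s, (f q s).length ≤ (F.f (p q) s).length)
    {q₀ : Q} (hq₀ : ∀ q, ∃ x, run τ q x = q₀)
    (hlt : ∃ x s, (f (run τ q₀ x) s).length < (F.f (p (run τ q₀ x)) s).length) : False := by
  have : Nonempty Q := ⟨q₀⟩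
  obtain ⟨-, -, hreg, hmin⟩ := hF
  let e := Finite.equivFin Q
  let F' := ofStates Q f τ
  have henc : ∀ (a : Fin F'.size) x, encode F'.f F'.τ a x = encode f τ (e.symm a) x :=
    fun a x => encode_equiv e f τ x a
  have hrun : ∀ (a : Fin F'.size) x, run F'.τ a x = e (run τ (e.symm a) x) :=
    fun a x => run_equiv e τ x a
  have hreach : ∀ a : Fin F'.size, ∃ x, run F'.τ a x = e q₀ := by
    intro a
    obtain ⟨x, hx⟩ := hq₀ (e.symm a)
    exact ⟨x, by rw [hrun, hx]⟩
  have hreg' : F'.IsRegular μ := isRegular_of_exists_run hμ hμ_sum hreach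
  have hext' : F'.IsExtendable := by
    refine (isExtendable_iff F').2 fun a => ?_
    obtain ⟨x, hx⟩ := hprod (e.symm a)
    exact ⟨x, by rwa [henc]⟩
  have hdec' : F'.IsDelayDecodable k := by
    refine isDelayDecodable_of_separates fun a s s' x x' c hs h h' => ?_
    rw [henc] at h h'
    exact hsep (e.symm a) s s' x x' c hs h h'
  refine (hmin F' hreg' hext' hdec').not_gt
    (avgLength_lt_of_cover hμ hμ_sum hreg hreg' (fun a => p (e.symm a)) (fun a s => ?_)
      (fun a s => hle (e.symm a) s) hreach ?_)
  · change p (e.symm (e (τ (e.symm a) s))) = _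
    rw [Equiv.symm_apply_apply, hp]
  · obtain ⟨x, s, hs⟩ := hlt
    refine ⟨x, s, ?_⟩
    have hx : e.symm (run F'.τ (e q₀) x) = run τ q₀ x :=
      (congrArg e.symm (hrun (e q₀) x)).trans (by simp)
    change (f (e.symm (run F'.τ (e q₀) x)) s).length <
      (F.f (p (e.symm (run F'.τ (e q₀) x))) s).length
    exact hx.symm ▸ hs

end Bridge

/-! ### No forced bits in an optimal code, and the theorem -/

/-- In the recurrent part of an optimal code-tuple no bit after the first `k` ones is forced. -/
theorem IsOptimal.exists_prefix_append {S : Type*} [Fintype S] [Nontrivial S] {μ : S → ℝ}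
    (hμ : ∀ s, 0 < μ s) (hμ_sum : ∑ s, μ s = 1) {k : ℕ} {F : CodeTuple S} (hF : F.IsOptimal μ k)
    {i : Fin F.size} (hi : i ∈ F.reachable) {d : List Bool} (hk : k ≤ d.length)
    (hd : ∃ x, d <+: encode F.f F.τ i x) (β : Bool) :
    ∃ x, d ++ [β] <+: encode F.f F.τ i x := by
  by_contra hβ
  rw [not_exists] at hβ
  have hprod : Productive F.f F.τ := (isExtendable_iff F).1 hF.1
  have hsep : Separates F.f F.τ k := hF.2.1.separates
  have hfin : Finite (PatternState F.f F.τ d β) := finite_patternState _ _ _ _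
  -- The bound k ≤ |d| enters here: restarting leaves all futures of at most |d| bits unchanged.
  have hredir : ∀ (q : PatternState F.f F.τ d β) s (c : List Bool), c.length ≤ k → _ :=
    fun q s c hc => exists_prefix_restartNext_iff i hβ hprod q s c (hc.trans hk)
  refine hF.false_of_cover hμ hμ_sum
    ((hsep.deleted hprod).redirect (τ' := restartNext i hβ) hredir)
    (hprod.deleted.redirect (hsep.deleted hprod) hredir)
    (fun q => q.1.1) (fst_restartNext i hβ) (fun q s => length_deleteAt_le _ _)
    (exists_run_eq_startState i hβ hprod fun j => ?_)
    (exists_length_deletedTable_lt_of_prefix i hβ hprod hd)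
  obtain ⟨x, hx⟩ := hi j
  exact ⟨x, by rw [← τStar_eq_run, hx]⟩

end CodeTuple

theorem theorem2 {S : Type*} [Fintype S] (hS : 2 ≤ Fintype.card S)
    (μ : S → ℝ) (hμ_pos : ∀ s, 0 < μ s) (hμ_sum : ∑ s, μ s = 1)
    (k : ℕ) (F : CodeTuple S) (hF : F.IsOptimal μ k)
    (i : Fin F.size) (hi : i ∈ F.reachable)
    (b : List Bool) (hb : k ≤ b.length) (hbk : b.take k ∈ F.pref k i []) :
    b ∈ F.prefStar i [] := by
  have : Nontrivial S := Fintype.one_lt_card_iff_nontrivial.1 hS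
  rw [CodeTuple.mem_pref_nil_iff] at hbk
  have key : ∀ n, k ≤ n → n ≤ b.length → ∃ x, b.take n <+: CodeTuple.encode F.f F.τ i x := by
    intro n hn
    induction n, hn using Nat.le_induction with
    | base => exact fun _ => hbk.2
    | succ n hn ih =>
      intro hnb
      rw [← List.take_append_getElem (by omega : n < b.length)]
      exact hF.exists_prefix_append hμ_pos hμ_sum hi
        (by rw [List.length_take]; omega) (ih (by omega)) _
  rw [CodeTuple.mem_prefStar_nil_iff]
  simpa using key b.length hb le_rfl
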